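/- Let $\Sigma_k=\{0,1,\dots,k-1\}$; words may be finite or infinite (to the right). A finite word $v$ is a repetition of exponent $|v|/p$ if $1\le p\le |v|$ and $p$ is a period of $v$, that is, $v_i=v_{i+p}$ whenever both letters exist. A word is $\alpha$-free (resp. $\alpha^+$-free) if no factor of it is a repetition of exponent $\ge\alpha$ (resp. $>\alpha$). A word over $\Sigma_4$ is reduced if none of $02,20,13,31$ is a factor of it; a Dean word is a reduced word that has no factor $uu$ with $u$ nonempty. A word avoids $v$ if $v$ is not a factor of it. Let $d_3(w)$ be the number of minimal absent words of length $3$ of $w$, that is, words of length $3$ over $\Sigma_4$ that are not factors of $w$ but all of whose proper prefixes and proper suffixes are factors of $w$. (i) There exists an infinite $\frac{15}{8}^+$-free Dean word avoiding $010$, $032$, $212$, $303$, and $323$. (ii) The image of every (finite or infinite) $\frac74^+$-free word over $\Sigma_3$ under the following $100$-uniform morphism $\Sigma_3^*\to\Sigma_4^*$ is a $\frac{15}{8}^+$-free Dean word avoiding $010$, $032$, $212$, $303$, and $323$: $$\begin{array}{ll} 0\to&01232101230121030123210121030121012321030123210123\\ &01210123210301210123012103012321030121012321012103\\ 1\to&01210123012103012321012301210123210121030121012321\\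 &03012321012103012101230121030123210123012101232103\\ 2\to&01210123012103012321012103012101232103012321012301\\ &21030123210301210123210121030123210123012101232103 \end{array}$$ (iii) If $w$ is a (finite or infinite) $\frac{15}{8}$-free Dean word with $d_3(w)\ge 5$, then $|w|\le 136$; in particular $w$ is finite. -/

import Mathlib

/-- A finite or infinite word over the alphabet `α`, i.e. an element of `Σ* ∪ Σ^ω`. -/
inductive CWord (α : Type) where
  | finite (w : List α)
  | infinite (w : ℕ → α)

namespace CWord

/-- The length of a word; it is `⊤` for an infinite word. -/
def length {α : Type} : CWord α → ℕ∞
  | finite w => (w.length : ℕ∞)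
  | infinite _ => ⊤

/-- `w.HasFactor v`: the finite word `v` is a factor (a contiguous finite subword) of `w`. -/
def HasFactor {α : Type} : CWord α → List α → Prop
  | finite w, v => v <:+: w
  | infinite w, v => ∃ i : ℕ, v = List.ofFn (fun j : Fin v.length => w (i + j))

/-- `w` avoids `v` if `v` is not a factor of `w`. -/
def Avoids {α : Type} (w : CWord α) (v : List α) : Prop :=
  ¬ w.HasFactor v

/-- A word is square-free if it has no factor `vv` with `v` nonempty. -/
def IsSquareFree {α : Type} (w : CWord α) : Prop :=
  ∀ v : List α, v ≠ [] → w.Avoids (v ++ v)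

/-- The natural number `p` is a period of the finite word `v`. -/
def HasPeriod {α : Type} (v : List α) (p : ℕ) : Prop :=
  ∀ i : ℕ, i + p < v.length → v[i]? = v[i + p]?

/-- `v` is a repetition of exponent `e`: it has a period `p` with `1 ≤ p ≤ |v|` and `e = |v| / p`. -/
def IsRepetition {α : Type} (v : List α) (e : ℚ) : Prop :=
  ∃ p : ℕ, 1 ≤ p ∧ p ≤ v.length ∧ HasPeriod v p ∧ e = (v.length : ℚ) / (p : ℚ)

/-- `w` is `a`-free: no factor of `w` is a repetition of exponent at least `a`. -/
def IsFree {α : Type} (a : ℚ) (w : CWord α) : Prop :=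
  ∀ (v : List α) (e : ℚ), w.HasFactor v → IsRepetition v e → ¬ a ≤ e

/-- `w` is `a⁺`-free: no factor of `w` is a repetition of exponent greater than `a`. -/
def IsPlusFree {α : Type} (a : ℚ) (w : CWord α) : Prop :=
  ∀ (v : List α) (e : ℚ), w.HasFactor v → IsRepetition v e → ¬ a < e

/-- The set of minimal absent words of length `l` of `w`: the absent words of length `l` all of
whose proper prefixes and proper suffixes occur in `w`. -/
def minAbsent {α : Type} (l : ℕ) (w : CWord α) : Set (List α) :=
  {v | v.length = l ∧ w.Avoids v ∧
    (∀ u : List α, u <+: v → u ≠ v → w.HasFactor u) ∧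
    (∀ u : List α, u <:+ v → u ≠ v → w.HasFactor u)}

/-- The number of minimal absent words of length `l` of `w`. -/
noncomputable def numMinAbsent {α : Type} (l : ℕ) (w : CWord α) : ℕ :=
  (minAbsent l w).ncard

/-- The image of a finite or infinite word under the `q`-uniform morphism that is given by the
images `h a`, of length `q ≥ 1`, of the letters `a`: the concatenation of the images of its
letters. -/
def image {α β : Type} (h : α → List β) (q : ℕ) (hq : 0 < q) (hh : ∀ a, (h a).length = q) :
    CWord α → CWord β
  | finite w => finite (w.flatMap h)
  | infinite w => infinite (fun n =>
      (h (w (n / q)))[n % q]'(by rw [hh]; exact Nat.mod_lt n hq))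

/-- A word over `{0, 1, 2, 3}` is reduced if it avoids `02`, `20`, `13` and `31`. -/
def IsReduced (w : CWord (Fin 4)) : Prop :=
  w.Avoids [0, 2] ∧ w.Avoids [2, 0] ∧ w.Avoids [1, 3] ∧ w.Avoids [3, 1]

/-- A Dean word is a square-free reduced word. -/
def IsDean (w : CWord (Fin 4)) : Prop :=
  w.IsReduced ∧ w.IsSquareFree

/-- `w` is a `15/8⁺`-free Dean word that avoids `010`, `032`, `212`, `303` and `323`. -/
def IsGood (w : CWord (Fin 4)) : Prop :=
  w.IsPlusFree (15 / 8) ∧ w.IsDean ∧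
    w.Avoids [0, 1, 0] ∧ w.Avoids [0, 3, 2] ∧ w.Avoids [2, 1, 2] ∧
    w.Avoids [3, 0, 3] ∧ w.Avoids [3, 2, 3]

end CWord

/-- The images of the letters under the explicit morphism from words over `{0, 1, 2}` to words
over `{0, 1, 2, 3}`. -/
def deanMorphism : Fin 3 → List (Fin 4)
  | 0 =>
    [0, 1, 2, 3, 2, 1, 0, 1, 2, 3, 0, 1, 2, 1, 0, 3, 0, 1, 2, 3, 2, 1, 0, 1, 2,
     1, 0, 3, 0, 1, 2, 1, 0, 1, 2, 3, 2, 1, 0, 3, 0, 1, 2, 3, 2, 1, 0, 1, 2, 3,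
     0, 1, 2, 1, 0, 1, 2, 3, 2, 1, 0, 3, 0, 1, 2, 1, 0, 1, 2, 3, 0, 1, 2, 1, 0,
     3, 0, 1, 2, 3, 2, 1, 0, 3, 0, 1, 2, 1, 0, 1, 2, 3, 2, 1, 0, 1, 2, 1, 0, 3]
  | 1 =>
    [0, 1, 2, 1, 0, 1, 2, 3, 0, 1, 2, 1, 0, 3, 0, 1, 2, 3, 2, 1, 0, 1, 2, 3, 0,
     1, 2, 1, 0, 1, 2, 3, 2, 1, 0, 1, 2, 1, 0, 3, 0, 1, 2, 1, 0, 1, 2, 3, 2, 1,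
     0, 3, 0, 1, 2, 3, 2, 1, 0, 1, 2, 1, 0, 3, 0, 1, 2, 1, 0, 1, 2, 3, 0, 1, 2,
     1, 0, 3, 0, 1, 2, 3, 2, 1, 0, 1, 2, 3, 0, 1, 2, 1, 0, 1, 2, 3, 2, 1, 0, 3]
  | 2 =>
    [0, 1, 2, 1, 0, 1, 2, 3, 0, 1, 2, 1, 0, 3, 0, 1, 2, 3, 2, 1, 0, 1, 2, 1, 0,
     3, 0, 1, 2, 1, 0, 1, 2, 3, 2, 1, 0, 3, 0, 1, 2, 3, 2, 1, 0, 1, 2, 3, 0, 1,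
     2, 1, 0, 3, 0, 1, 2, 3, 2, 1, 0, 3, 0, 1, 2, 1, 0, 1, 2, 3, 2, 1, 0, 1, 2,
     1, 0, 3, 0, 1, 2, 3, 2, 1, 0, 1, 2, 3, 0, 1, 2, 1, 0, 1, 2, 3, 2, 1, 0, 3]

theorem deanMorphism_length : ∀ a : Fin 3, (deanMorphism a).length = 100 := by
  intro a
  fin_cases a <;> rfl

/-!
**Repetitions in images of uniform morphisms.** Write a repetition of period `p` as a stretch of `m`
letters, its excess, that agrees with its shift by `p`; its exponent is `1 + m / p`. Consider the
image of a sequence over three letters, with no two consecutive letters equal, under a `q`-uniform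
morphism.

* If `q` does not divide `p`, then `m` is smaller than the synchronization length `L`: a window of
  `L` letters of an image determines its starting place modulo `q`
  (`mod_eq_of_isSynchronized`). If the exponent is too large, this bounds `p`, and the repetition
  already occurs in the image of a word of length `3`. Both the synchronization and the absence of
  such short repetitions are finite checks (`excess_le_of_not_dvd`).
* If `p = q * P`, then the repetition comes from one of period `P` in the preimage, and `m` exceeds
  `q` times the excess of the latter by at most the lengths of a common suffix and of a common
  prefix of two distinct blocks (`exists_preimage_stretch`).

For Dejean's `19`-uniform morphism, distinct blocks have no common prefix or suffix, so the exponent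
of a repetition of period `19 * P` is that of its preimage. By induction on the period, its fixed
point is `7/4⁺`-free (`isPlusFree_dejeanWord`). For `deanMorphism`, common prefixes and suffixes
have at most `23` and `28` letters. The excess `M ≤ 3 * P / 4` in the preimage then gives
`m ≤ 100 * M + 51`, which is at most `7 / 8 * (100 * P)` unless `P = 4` and `M = 3`; in that case,
the flanking letters are `1` and `2`, and the preimage would contain a square. The image of
Dejean's word proves the existence statement.

**The bound `136`.** In a Dean word, consecutive letters are adjacent in the cyclic order `0123`. So
there are only `16` candidates for factors and for minimal absent words of length `3`, and at least
five minimal absent words leave at most `11` factors (`card_add_numMinAbsent_le`). Up to the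
symmetries of the cyclic order, a word starts with `01`. A backtracking search over the words that
start in this way, which closes a branch when a twelfth factor of length `3` or a suffix of exponent
at least `15/8` with a period in `searchPeriods` appears, does not reach length
`137` (`noExtension_searchTable`, `noExtension_sound`).
-/

/-! ### Factors and repetitions in terms of letters -/

namespace CWord

/-- The `i`-th letter of a word; beyond the end of a finite word it is the default letter. -/
def letter {α : Type} [Inhabited α] : CWord α → ℕ → α
  | finite w, i => w.getD i default
  | infinite w, i => w i

theorem hasFactor_iff {α : Type} [Inhabited α] (w : CWord α) (v : List α) :
    w.HasFactor v ↔ ∃ i : ℕ, ((i + v.length : ℕ) : ℕ∞) ≤ w.length ∧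
      ∀ j (hj : j < v.length), v[j] = w.letter (i + j) := by
  cases w with
  | finite l =>
    simp only [HasFactor, length, letter, Nat.cast_le]
    constructor
    · rintro ⟨s, t, rfl⟩
      refine ⟨s.length, by simp, fun j hj => ?_⟩
      rw [List.getD_eq_getElem _ _ (by simp; omega)]
      simp [hj]
    · rintro ⟨i, hi, h⟩
      have : v = (l.drop i).take v.length := by
        apply List.ext_getElem
        · simp; omega
        · intro j h1 h2
          rw [h j h1, List.getD_eq_getElem _ _ (by omega)]
          simp
      rw [this]
      exact (List.take_prefix _ _).isInfix.trans (List.drop_suffix _ _).isInfix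
  | infinite f =>
    simp only [HasFactor, length, letter, le_top, true_and]
    refine exists_congr fun i => ?_
    constructor
    · intro h j hj
      have := List.getElem_of_eq h hj
      simpa using this
    · intro h
      apply List.ext_getElem
      · simp
      · intro j h1 h2
        simp [h j h1]

theorem hasFactor_ofFn {α : Type} [Inhabited α] (w : CWord α) {i n : ℕ}
    (h : ((i + n : ℕ) : ℕ∞) ≤ w.length) :
    w.HasFactor (List.ofFn fun j : Fin n => w.letter (i + j)) := by
  rw [hasFactor_iff]
  exact ⟨i, by simpa using h, fun j hj => by simp⟩

/-- A stretch of `m` letters of `w` that agrees with its shift by `p ≤ p + m` is a repetition of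
length `p + m` and period `p`. -/
theorem exists_repetition {α : Type} [Inhabited α] (w : CWord α) {i p m : ℕ} (hp : 1 ≤ p)
    (hfit : ((i + (p + m) : ℕ) : ℕ∞) ≤ w.length)
    (h : ∀ j < m, w.letter (i + j) = w.letter (i + j + p)) :
    ∃ v, w.HasFactor v ∧ IsRepetition v (((p + m : ℕ) : ℚ) / p) := by
  refine ⟨_, hasFactor_ofFn w hfit, p, hp, by simp, ?_, by simp⟩
  intro j hj
  rw [List.length_ofFn] at hj
  rw [List.getElem?_eq_getElem (by simp; omega), List.getElem?_eq_getElem (by simp; omega)]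
  simp only [List.getElem_ofFn, Option.some.injEq]
  rw [h j (by omega), Nat.add_assoc]

theorem repetition_letter {α : Type} [Inhabited α] {w : CWord α} {v : List α} {e : ℚ}
    (hv : w.HasFactor v) (he : IsRepetition v e) :
    ∃ i p m : ℕ, 1 ≤ p ∧ v.length = p + m ∧ e = ((p + m : ℕ) : ℚ) / p ∧
      ((i + (p + m) : ℕ) : ℕ∞) ≤ w.length ∧
      ∀ j < m, w.letter (i + j) = w.letter (i + j + p) := by
  obtain ⟨p, hp1, hp2, hper, rfl⟩ := he
  obtain ⟨i, hi, hl⟩ := (hasFactor_iff w v).1 hv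
  refine ⟨i, p, v.length - p, hp1, by omega, by rw [Nat.add_sub_cancel' hp2], ?_, ?_⟩
  · rwa [Nat.add_sub_cancel' hp2]
  · intro j hj
    have h1 := hper j (by omega)
    rw [List.getElem?_eq_getElem (by omega), List.getElem?_eq_getElem (by omega),
      Option.some.injEq, hl, hl] at h1
    rw [h1, Nat.add_assoc]

theorem div_lt_exponent {a b p m : ℕ} (hb : 0 < b) (hp : 1 ≤ p) :
    (1 + (a : ℚ) / b < ((p + m : ℕ) : ℚ) / p) ↔ a * p < b * m := by
  have hb' : (0 : ℚ) < b := by exact_mod_cast hb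
  have hp' : (0 : ℚ) < p := by exact_mod_cast hp
  rw [Nat.cast_add, add_div, div_self hp'.ne', add_lt_add_iff_left, div_lt_div_iff₀ hb' hp',
    mul_comm (m : ℚ)]
  exact_mod_cast Iff.rfl

/-- Being `(1 + a / b)⁺`-free, for a word: an excess `m` over a period `p` satisfies
`m / p ≤ a / b`. -/
theorem isPlusFree_iff {α : Type} [Inhabited α] (w : CWord α) {a b : ℕ} (hb : 0 < b) :
    w.IsPlusFree (1 + (a : ℚ) / b) ↔ ∀ i p m : ℕ, 1 ≤ p →
      ((i + (p + m) : ℕ) : ℕ∞) ≤ w.length →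
      (∀ j < m, w.letter (i + j) = w.letter (i + j + p)) → b * m ≤ a * p := by
  constructor
  · intro h i p m hp hfit hm
    obtain ⟨v, hv, hr⟩ := exists_repetition w hp hfit hm
    have := h v _ hv hr
    rw [div_lt_exponent hb hp] at this
    exact not_lt.1 this
  · intro h v e hv he
    obtain ⟨i, p, m, hp, -, rfl, hfit, hm⟩ := repetition_letter hv he
    rw [div_lt_exponent hb hp]
    exact not_lt.2 (h i p m hp hfit hm)

theorem IsFree.excess_lt {α : Type} [Inhabited α] {w : CWord α} (h : w.IsFree (15 / 8))
    {i p m : ℕ} (hp : 1 ≤ p) (hfit : ((i + (p + m) : ℕ) : ℕ∞) ≤ w.length)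
    (hm : ∀ j < m, w.letter (i + j) = w.letter (i + j + p)) : 8 * m < 7 * p := by
  obtain ⟨v, hv, hr⟩ := exists_repetition w hp hfit hm
  have := h v _ hv hr
  by_contra hcon
  apply this
  have hp' : (0 : ℚ) < p := by exact_mod_cast hp
  rw [le_div_iff₀ hp']
  have : (7 * p : ℚ) ≤ 8 * m := by exact_mod_cast not_lt.1 hcon
  push_cast
  linarith

/-- Squares have exponent `2`. -/
theorem IsPlusFree.isSquareFree {α : Type} [Inhabited α] {w : CWord α} {e : ℚ} (he : e < 2)
    (h : w.IsPlusFree e) : w.IsSquareFree := by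
  intro v hv hf
  have hl : 1 ≤ v.length := List.length_pos_iff.2 hv
  refine h _ 2 hf ⟨v.length, hl, by simp, ?_, ?_⟩ he
  · intro i hi
    rw [List.length_append] at hi
    rw [List.getElem?_append_left (by omega), List.getElem?_append_right (by omega),
      Nat.add_sub_cancel]
  · have : (v.length : ℚ) ≠ 0 := by exact_mod_cast (by omega : v.length ≠ 0)
    rw [List.length_append]
    push_cast
    field_simp
    norm_num

end CWord

/-! ### A backtracking search on coded words -/

namespace DeanWords

open CWord

/-- The number whose base-`5` digits are `g 0, …, g (n - 1)`, the last one least significant. It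
codes the prefix of length `n` of `g` when all `g i` lie in `{1, 2, 3, 4}`; the digit `0` then
stands for the absence of a letter. -/
def code (g : ℕ → ℕ) : ℕ → ℕ
  | 0 => 0
  | n + 1 => 5 * code g n + g n

theorem code_digit {g : ℕ → ℕ} (hg : ∀ i, g i < 5) (n k : ℕ) :
    code g n / 5 ^ k % 5 = if k < n then g (n - 1 - k) else 0 := by
  induction n generalizing k with
  | zero => simp [code]
  | succ n ih =>
    have := hg n
    cases k with
    | zero => simp [code]; omega
    | succ k =>
      have h : code g (n + 1) / 5 ^ (k + 1) = code g n / 5 ^ k := by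
        rw [pow_succ', ← Nat.div_div_eq_div_mul]
        congr 1
        simp only [code]
        omega
      rw [h, ih]
      simp only [Nat.succ_lt_succ_iff]
      congr 2
      omega

theorem digit_mod_pow {x j m : ℕ} (hj : j < m) : x % 5 ^ m / 5 ^ j % 5 = x / 5 ^ j % 5 := by
  obtain ⟨d, rfl⟩ := Nat.exists_eq_add_of_lt hj
  rw [show j + d + 1 = j + (d + 1) by ring, pow_add, Nat.mod_mul_right_div_self,
    pow_succ', Nat.mod_mul_right_mod]

/-- Because letters are nonzero digits, the equality of the last `m` digits with the `m` digits
that end `p` places earlier forces the latter to exist. -/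
theorem suffix_repetition {g : ℕ → ℕ} (hg : ∀ i, 0 < g i ∧ g i < 5) {n p m : ℕ} (hn : 0 < n)
    (hp : 0 < p) (hm : 0 < m) (h : code g n % 5 ^ m = code g n / 5 ^ p % 5 ^ m) :
    p + m ≤ n ∧ ∀ j < m, g (n - 1 - j) = g (n - 1 - j - p) := by
  have key : ∀ j < m, (if j < n then g (n - 1 - j) else 0) =
      if p + j < n then g (n - 1 - (p + j)) else 0 := by
    intro j hj
    rw [← code_digit fun i => (hg i).2, ← code_digit fun i => (hg i).2, ← digit_mod_pow hj, h,
      digit_mod_pow hj, pow_add, Nat.div_div_eq_div_mul]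
  have hlt : ∀ j < m, p + j < n := by
    intro j hj
    induction j with
    | zero =>
      have := key 0 hj
      rw [if_pos hn] at this
      by_contra hc
      rw [if_neg hc] at this
      have := (hg (n - 1 - 0)).1
      omega
    | succ j ih =>
      have h1 := ih (by omega)
      have := key (j + 1) hj
      rw [if_pos (by omega : j + 1 < n)] at this
      by_contra hc
      rw [if_neg hc] at this
      have := (hg (n - 1 - (j + 1))).1
      omega
  refine ⟨by have := hlt (m - 1) (by omega); omega, fun j hj => ?_⟩
  have h1 := hlt j hj
  have h2 := key j hj
  rw [if_pos h1, if_pos (by omega)] at h2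
  rw [h2]
  congr 1
  omega

/-! The definitions below are written with recursors and with the binary operations of `Nat`
themselves, because it is the kernel that evaluates them. Base `5` rather than a power of two
keeps the hashes of the codes apart, which are computed modulo `2 ^ 64`. -/

/-- The value `k n`. In the kernel, `n` is evaluated to a numeral before `k` is applied. -/
noncomputable def force (n : ℕ) (k : ℕ → Bool) : Bool := n.rec (k 0) fun m _ => k m.succ

theorem force_eq (n : ℕ) (k : ℕ → Bool) : force n k = k n := by
  cases n <;> rfl

/-- Whether, for some entry `(5 ^ p, 5 ^ m)` of the table `T`, the last `m` digits of `c` agree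
with the `m` digits that end `p` places earlier. -/
noncomputable def hasPeriodicSuffix (T : List (ℕ × ℕ)) (c : ℕ) : Bool :=
  T.rec false fun h _ ih => (Nat.beq (c.mod h.2) ((c.div h.1).mod h.2)).rec ih true

/-- One step of the search, after the letter that completes the code `c` was appended: the branch
is closed if the word has a forbidden periodic suffix, or if its last factor of length `3` is new
and no new factor is allowed (`rem = 0`). The set of factors of length `3` seen before is the set
of the binary digits `1` of `mask`. -/
noncomputable def visit (T : List (ℕ × ℕ)) (search : ℕ → ℕ → ℕ → Bool) (mask rem c : ℕ) : Bool :=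
  (hasPeriodicSuffix T c).rec
    ((Nat.beq 1 ((mask.shiftRight (c.mod (nat_lit 125))).mod (nat_lit 2))).rec
      (rem.rec true fun r _ => search c (mask.lor ((nat_lit 2).pow (c.mod (nat_lit 125)))) r)
      (search c mask rem)) true

/-- `noExtension T k c mask rem` means that the backtracking search finds no way to append `k`
letters to the word with code `c`, where consecutive letters are cyclically adjacent in
`{1, 2, 3, 4}`, no periodic suffix from the table `T` arises, and at most `rem` factors of length
`3` outside `mask` are used. -/
noncomputable def noExtension (T : List (ℕ × ℕ)) (k : ℕ) : ℕ → ℕ → ℕ → Bool :=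
  k.rec (fun _ _ _ => false) fun _ ih c mask rem =>
    (force (((nat_lit 5).mul c).add (Nat.succ ((c.mod (nat_lit 5)).mod (nat_lit 4))))
      (visit T ih mask rem)).rec false
    (force (((nat_lit 5).mul c).add
      (Nat.succ (((c.mod (nat_lit 5)).add (nat_lit 2)).mod (nat_lit 4)))) (visit T ih mask rem))

theorem hasPeriodicSuffix_eq_true {T : List (ℕ × ℕ)} {c : ℕ}
    (h : hasPeriodicSuffix T c = true) : ∃ x ∈ T, c % x.2 = c / x.1 % x.2 := by
  induction T with
  | nil => exact absurd h (by simp [hasPeriodicSuffix])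
  | cons x T ih =>
    change (Nat.beq (c % x.2) (c / x.1 % x.2)).rec (hasPeriodicSuffix T c) true = true at h
    cases hb : Nat.beq (c % x.2) (c / x.1 % x.2) with
    | true => exact ⟨x, by simp, Nat.eq_of_beq_eq_true hb⟩
    | false =>
      rw [hb] at h
      obtain ⟨y, hy, hy'⟩ := ih h
      exact ⟨y, by simp [hy], hy'⟩

theorem noExtension_succ {T : List (ℕ × ℕ)} {k c mask rem : ℕ}
    (h : noExtension T (k + 1) c mask rem = true) :
    visit T (noExtension T k) mask rem (5 * c + (c % 5 % 4 + 1)) = true ∧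
    visit T (noExtension T k) mask rem (5 * c + ((c % 5 + 2) % 4 + 1)) = true := by
  change (force (5 * c + (c % 5 % 4 + 1)) (visit T (noExtension T k) mask rem)).rec false
    (force (5 * c + ((c % 5 + 2) % 4 + 1)) (visit T (noExtension T k) mask rem)) = true at h
  rw [force_eq, force_eq] at h
  revert h
  cases visit T (noExtension T k) mask rem (5 * c + (c % 5 % 4 + 1)) <;> simp

theorem visit_cases {T : List (ℕ × ℕ)} {search : ℕ → ℕ → ℕ → Bool} {mask rem c : ℕ}
    (h : visit T search mask rem c = true) :
    hasPeriodicSuffix T c = true ∨ (mask.testBit (c % 125) = true ∧ search c mask rem = true) ∨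
    (mask.testBit (c % 125) = false ∧
      (rem = 0 ∨ ∃ r, rem = r + 1 ∧ search c (mask ||| 2 ^ (c % 125)) r = true)) := by
  cases h1 : hasPeriodicSuffix T c with
  | true => exact Or.inl rfl
  | false =>
    right
    change (hasPeriodicSuffix T c).rec ((Nat.beq 1 ((mask >>> (c % 125)) % 2)).rec
      (rem.rec true fun r _ => search c (mask ||| 2 ^ (c % 125)) r)
      (search c mask rem)) true = true at h
    rw [h1] at h
    change (Nat.beq 1 ((mask >>> (c % 125)) % 2)).rec
      (rem.rec true fun r _ => search c (mask ||| 2 ^ (c % 125)) r)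
      (search c mask rem) = true at h
    have ht : mask.testBit (c % 125) = Nat.beq 1 ((mask >>> (c % 125)) % 2) := by
      rw [Nat.testBit_eq_decide_div_mod_eq, Nat.shiftRight_eq_div_pow]
      refine Bool.eq_iff_iff.2 ⟨fun ha => ?_, fun ha => ?_⟩
      · rw [of_decide_eq_true ha]
        rfl
      · exact decide_eq_true (Nat.eq_of_beq_eq_true ha).symm
    rw [← ht] at h
    cases hb : mask.testBit (c % 125) with
    | true => rw [hb] at h; exact Or.inl ⟨rfl, h⟩
    | false =>
      rw [hb] at h
      refine Or.inr ⟨rfl, ?_⟩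
      cases rem with
      | zero => exact Or.inl rfl
      | succ r => exact Or.inr ⟨r, rfl, h⟩

/-- Soundness of the search: a sequence of `N` letters that starts with the given prefix and
respects the constraints of the search contradicts the search result. -/
theorem noExtension_sound {T : List (ℕ × ℕ)} {g : ℕ → ℕ} {N K : ℕ}
    (hT : ∀ n ≤ N, 0 < n → hasPeriodicSuffix T (code g n) = false) (hg : ∀ i, 0 < g i ∧ g i < 5)
    (hadj : ∀ n, n + 1 < N → g (n + 1) = g n % 4 + 1 ∨ g (n + 1) = (g n + 2) % 4 + 1)
    {F : Finset ℕ} (hF : ∀ n < N, 2 ≤ n → code g (n + 1) % 125 ∈ F) (hK : F.card ≤ K)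
    (k : ℕ) : ∀ (n mask rem : ℕ) (S : Finset ℕ), n + k = N → 2 ≤ n → S ⊆ F →
      (∀ t, mask.testBit t = true ↔ t ∈ S) → S.card + rem = K →
      noExtension T k (code g n) mask rem ≠ true := by
  induction k with
  | zero => intro n mask rem S _ _ _ _ _ h; cases h
  | succ k ih =>
    intro n mask rem S hn h2 hS hmask hrem h
    have hmod : code g n % 5 = g (n - 1) := by
      have := code_digit (fun i => (hg i).2) n 0
      rw [pow_zero, Nat.div_one, if_pos (by omega)] at this
      simpa using this
    have hv : visit T (noExtension T k) mask rem (code g (n + 1)) = true := by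
      obtain ⟨ha, hb⟩ := noExtension_succ h
      have := hadj (n - 1) (by omega)
      rw [Nat.sub_add_cancel (by omega), ← hmod] at this
      simp only [code]
      rcases this with h' | h' <;> rw [h']
      exacts [ha, hb]
    have hmem := hF n (by omega) h2
    rcases visit_cases hv with h' | ⟨h', hs⟩ | ⟨h', hs⟩
    · rw [hT (n + 1) (by omega) (by omega)] at h'
      cases h'
    · exact ih (n + 1) mask rem S (by omega) (by omega) hS hmask hrem hs
    · have hnot : code g (n + 1) % 125 ∉ S := by
        rw [← hmask, h']
        simp
      have hsub : insert (code g (n + 1) % 125) S ⊆ F := Finset.insert_subset hmem hS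
      rcases hs with rfl | ⟨r, rfl, hs⟩
      · have := Finset.card_le_card hsub
        rw [Finset.card_insert_of_notMem hnot] at this
        omega
      · refine ih (n + 1) _ r _ (by omega) (by omega) hsub ?_ ?_ hs
        · intro t
          rw [Nat.testBit_lor, Nat.testBit_two_pow, Bool.or_eq_true, hmask, Finset.mem_insert,
            decide_eq_true_eq]
          tauto
        · rw [Finset.card_insert_of_notMem hnot]
          omega

/-- Periods `p` for which the search forbids a suffix of exponent at least `15 / 8`. -/
def searchPeriods : List ℕ := [4, 6, 8, 2, 12, 16, 26, 36, 40, 10, 14, 22]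

/-- The table of the pairs `(5 ^ p, 5 ^ m)` with `m = ⌈7 p / 8⌉`. -/
def searchTable : List (ℕ × ℕ) := searchPeriods.map fun p => (5 ^ p, 5 ^ ((7 * p + 7) / 8))

set_option maxRecDepth 100000 in
/-- The exhaustive search from the word `12` (code `7`) to length `2 + 135 = 137`, with at most
`11` factors of length `3`; its tree has about `70000` nodes. -/
theorem noExtension_searchTable : noExtension searchTable 135 7 0 11 = true := by
  decide +kernel

/-! ### Dean words with few factors of length three -/

theorem adjacent_of_isDean {w : CWord (Fin 4)} (hw : w.IsDean) {a b : Fin 4}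
    (h : w.HasFactor [a, b]) : b = a + 1 ∨ b = a + 3 := by
  obtain ⟨⟨h1, h2, h3, h4⟩, hsq⟩ := hw
  have h5 : a ≠ b := by
    rintro rfl
    exact hsq [a] (by simp) h
  have e1 : ¬ (a = 0 ∧ b = 2) := by rintro ⟨rfl, rfl⟩; exact h1 h
  have e2 : ¬ (a = 2 ∧ b = 0) := by rintro ⟨rfl, rfl⟩; exact h2 h
  have e3 : ¬ (a = 1 ∧ b = 3) := by rintro ⟨rfl, rfl⟩; exact h3 h
  have e4 : ¬ (a = 3 ∧ b = 1) := by rintro ⟨rfl, rfl⟩; exact h4 h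
  clear h h1 h2 h3 h4 hsq
  revert a b
  decide

/-- The `16` words of length `3` over `{0, 1, 2, 3}` with cyclically adjacent consecutive
letters. -/
def adjacentTriples : Finset (List (Fin 4)) :=
  (Finset.univ : Finset (Fin 4 × Bool × Bool)).image fun t =>
    let b := t.1 + bif t.2.1 then 1 else 3
    [t.1, b, b + bif t.2.2 then 1 else 3]

theorem mem_adjacentTriples {a b c : Fin 4} (h1 : b = a + 1 ∨ b = a + 3)
    (h2 : c = b + 1 ∨ c = b + 3) : [a, b, c] ∈ adjacentTriples := by
  rw [adjacentTriples, Finset.mem_image]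
  rcases h1 with rfl | rfl <;> rcases h2 with rfl | rfl
  exacts [⟨(a, true, true), by simp⟩, ⟨(a, true, false), by simp⟩, ⟨(a, false, true), by simp⟩,
    ⟨(a, false, false), by simp⟩]

theorem card_adjacentTriples_le : adjacentTriples.card ≤ 16 :=
  Finset.card_image_le.trans (by simp)

theorem minAbsent_subset_adjacentTriples {w : CWord (Fin 4)} (hw : w.IsDean) :
    minAbsent 3 w ⊆ adjacentTriples := by
  rintro v ⟨hl, -, hpre, hsuf⟩
  match v, hl with
  | [a, b, c], _ =>
    exact mem_adjacentTriples (adjacent_of_isDean hw (hpre [a, b] ⟨[c], rfl⟩ (by simp)))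
      (adjacent_of_isDean hw (hsuf [b, c] ⟨[a], rfl⟩ (by simp)))

/-- Every factor of length `3` uses up one of the `16` candidates for minimal absent words. -/
theorem card_add_numMinAbsent_le {w : CWord (Fin 4)} (hw : w.IsDean) {F : Finset (List (Fin 4))}
    (hF : ∀ v ∈ F, w.HasFactor v ∧ v ∈ adjacentTriples) : F.card + w.numMinAbsent 3 ≤ 16 := by
  have hfin : (minAbsent 3 w).Finite :=
    adjacentTriples.finite_toSet.subset (minAbsent_subset_adjacentTriples hw)
  have hdisj : Disjoint (F : Set (List (Fin 4))) (minAbsent 3 w) :=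
    Set.disjoint_left.2 fun v hv hv' => hv'.2.1 (hF v hv).1
  have h := Set.ncard_le_ncard (Set.union_subset (fun v hv => (hF v hv).2)
    (minAbsent_subset_adjacentTriples hw) : (F : Set (List (Fin 4))) ∪ minAbsent 3 w ⊆ _)
    adjacentTriples.finite_toSet
  rw [Set.ncard_union_eq hdisj F.finite_toSet hfin, Set.ncard_coe_finset,
    Set.ncard_coe_finset] at h
  exact h.trans card_adjacentTriples_le

/-- The symmetry of the cyclic order `0123` that takes `a` to the first letter, as a map to the
digits `1, 2, 3, 4`; the flag `s` says whether the orientation is kept. -/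
def relabel (a : Fin 4) (s : Bool) (y : Fin 4) : ℕ := (bif s then y - a else a - y).val + 1

theorem relabel_injective (a : Fin 4) (s : Bool) : Function.Injective (relabel a s) := by
  revert a s
  unfold Function.Injective
  decide

theorem relabel_adjacent (a : Fin 4) (s : Bool) {y z : Fin 4} (h : z = y + 1 ∨ z = y + 3) :
    relabel a s z = relabel a s y % 4 + 1 ∨ relabel a s z = (relabel a s y + 2) % 4 + 1 := by
  revert a s y z
  decide

theorem exists_relabel {a b : Fin 4} (h : b = a + 1 ∨ b = a + 3) :
    ∃ s, relabel a s a = 1 ∧ relabel a s b = 2 := by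
  revert a b
  decide

theorem pos_of_mem_searchPeriods : ∀ p ∈ searchPeriods, 0 < p := by decide

/-- A `15/8`-free Dean word with at least five minimal absent words of length `3` has at most `136`
letters: otherwise its first `137` letters, relabelled to start with `12`, contradict
`noExtension_searchTable`. -/
theorem length_le_of_numMinAbsent {w : CWord (Fin 4)} (hw : w.IsDean) (hfree : w.IsFree (15 / 8))
    (h5 : 5 ≤ w.numMinAbsent 3) : w.length ≤ 136 := by
  by_contra hlen
  have hlen : ((137 : ℕ) : ℕ∞) ≤ w.length := Order.add_one_le_of_lt (not_le.1 hlen)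
  have hfit : ∀ n : ℕ, n ≤ 137 → ((n : ℕ) : ℕ∞) ≤ w.length :=
    fun n hn => le_trans (by exact_mod_cast hn) hlen
  set x := w.letter with hx
  have hadj : ∀ i, i + 1 < 137 → x (i + 1) = x i + 1 ∨ x (i + 1) = x i + 3 := by
    intro i hi
    apply adjacent_of_isDean hw
    have := hasFactor_ofFn w (hfit (i + 2 : ℕ) (by omega))
    simpa [List.ofFn_succ] using this
  set F : Finset (List (Fin 4)) :=
    (Finset.range 135).image fun i => [x i, x (i + 1), x (i + 2)] with hFdef
  have hF : F.card ≤ 11 := by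
    have := card_add_numMinAbsent_le hw (F := F) (by
      intro v hv
      obtain ⟨i, hi, rfl⟩ := Finset.mem_image.1 hv
      rw [Finset.mem_range] at hi
      refine ⟨?_, mem_adjacentTriples (hadj i (by omega)) (hadj (i + 1) (by omega))⟩
      have := hasFactor_ofFn w (hfit (i + 3 : ℕ) (by omega))
      simpa [List.ofFn_succ] using this)
    omega
  obtain ⟨s, hs0, hs1⟩ := exists_relabel (hadj 0 (by omega))
  set g : ℕ → ℕ := fun i => relabel (x 0) s (x i) with hg
  have hgb : ∀ i, 0 < g i ∧ g i < 5 := fun i => ⟨Nat.succ_pos _, Nat.succ_lt_succ (Fin.isLt _)⟩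
  refine noExtension_sound (T := searchTable) (g := g) (N := 137) (K := 11) ?_ hgb ?_
    (F := F.image fun l => l.foldl (fun c y => 5 * c + relabel (x 0) s y) 0) ?_
    (Finset.card_image_le.trans hF) 135 2 0 11 ∅ rfl le_rfl (Finset.empty_subset _) (by simp)
    rfl ?_
  · intro n hn hn0
    by_contra hcon
    obtain ⟨y, hy, hmod⟩ := hasPeriodicSuffix_eq_true (Bool.not_eq_false _ ▸ hcon)
    obtain ⟨p, hp, rfl⟩ := List.mem_map.1 hy
    have hp0 := pos_of_mem_searchPeriods p hp
    obtain ⟨hle, heq⟩ := suffix_repetition hgb hn0 hp0 (by omega) hmod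
    have := hfree.excess_lt (i := n - (p + (7 * p + 7) / 8)) (p := p) (m := (7 * p + 7) / 8) hp0
      (hfit (n - (p + (7 * p + 7) / 8) + (p + (7 * p + 7) / 8) : ℕ) (by omega)) (by
        intro j hj
        have := relabel_injective _ _ (heq ((7 * p + 7) / 8 - 1 - j) (by omega))
        rw [← hx]
        convert this.symm using 2 <;> omega)
    omega
  · intro n hn
    exact relabel_adjacent _ _ (hadj n hn)
  · intro n hn h2
    obtain ⟨i, rfl⟩ := Nat.exists_eq_add_of_le' h2
    refine Finset.mem_image.2 ⟨[x i, x (i + 1), x (i + 2)],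
      Finset.mem_image.2 ⟨i, Finset.mem_range.2 (by omega), rfl⟩, ?_⟩
    have h0 := hgb i
    have h1 := hgb (i + 1)
    have h2 := hgb (i + 2)
    simp only [List.foldl_cons, List.foldl_nil, code]
    simp only [hg] at h0 h1 h2 ⊢
    omega
  · have : code g 2 = 7 := by
      simp only [code, hg, Nat.reduceAdd] at hs1 ⊢
      rw [hs0, hs1]
    rw [this]
    exact noExtension_searchTable

/-! ### Preimages of repetitions, synchronization, and short repetitions -/

/-- A stretch of `m` letters of the image of `f` under a `q`-uniform map that agrees with its shift
by `q * P` comes from a stretch `[a, b)` of `f` that agrees with its shift by `P`: the excess `m`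
is at most `q * (b - a)`, plus a contribution `x` of a common suffix of two distinct blocks on the
left, plus a contribution `y` of a common prefix on the right. The only exception is a stretch of
length at most `R` inside a block. -/
theorem exists_preimage_stretch {α β : Type} {blk : α → ℕ → β} {q R : ℕ} (hq : 0 < q)
    {pre suf : α → α → ℕ}
    (hpre : ∀ a b, a ≠ b → ∃ r < q, r ≤ pre a b ∧ blk a r ≠ blk b r)
    (hsuf : ∀ a b, a ≠ b → ∃ r < q, q ≤ r + suf a b + 1 ∧ blk a r ≠ blk b r)
    (hmid : ∀ a b, a ≠ b → ∀ i, i + R < q → ∃ j ≤ R, blk a (i + j) ≠ blk b (i + j))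
    {f : ℕ → α} {i P m : ℕ} (hm0 : 0 < m)
    (hm : ∀ j < m, blk (f ((i + j) / q)) ((i + j) % q) = blk (f ((i + j) / q + P)) ((i + j) % q)) :
    m ≤ R ∨ ∃ a b x y, a ≤ b ∧ (∀ J, a ≤ J → J < b → f J = f (J + P)) ∧
      m ≤ q * (b - a) + x + y ∧ q * b < i + m + q ∧
      (x = 0 ∨ ∃ a', a = a' + 1 ∧ f a' ≠ f (a' + P) ∧ x ≤ suf (f a') (f (a' + P))) ∧
      (y = 0 ∨ f b ≠ f (b + P) ∧ y ≤ pre (f b) (f (b + P)) ∧ q * b < i + m) := by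
  classical
  have hblk : ∀ J t, t < q → i ≤ q * J + t → q * J + t < i + m →
      blk (f J) t = blk (f (J + P)) t := by
    intro J t ht h1 h2
    have := hm (q * J + t - i) (by omega)
    rwa [Nat.add_sub_cancel' h1, Nat.mul_add_div hq, Nat.div_eq_of_lt ht, Nat.mul_add_mod,
      Nat.mod_eq_of_lt ht, Nat.add_zero] at this
  obtain ⟨A, r, hr, rfl⟩ : ∃ A r, r < q ∧ i = q * A + r :=
    ⟨i / q, i % q, Nat.mod_lt _ hq, (Nat.div_add_mod i q).symm⟩
  obtain ⟨B, s, hs, hB⟩ : ∃ B s, s < q ∧ q * A + r + m = q * B + s :=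
    ⟨_ / q, _ % q, Nat.mod_lt _ hq, (Nat.div_add_mod _ q).symm⟩
  have hAB : A ≤ B := by
    by_contra hcon
    have : q * (B + 1) ≤ q * A := Nat.mul_le_mul_left q (by omega)
    rw [Nat.mul_succ] at this
    omega
  obtain ⟨d, rfl⟩ := Nat.exists_eq_add_of_le hAB
  rcases Nat.eq_zero_or_pos d with rfl | hd
  · rw [Nat.add_zero] at hB
    by_cases hf : f A = f (A + P)
    · refine Or.inr ⟨A, A + 1, 0, 0, by omega, ?_, ?_, ?_, Or.inl rfl, Or.inl rfl⟩
      · intro J h1 h2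
        obtain rfl : J = A := by omega
        exact hf
      · rw [Nat.add_sub_cancel_left]
        omega
      · rw [Nat.mul_succ]
        omega
    · left
      by_contra hR
      obtain ⟨j, hj, hne⟩ := hmid _ _ hf r (by omega)
      exact hne (hblk A (r + j) (by omega) (by omega) (by omega))
  · right
    have hmul : q * (A + d) = q * A + q * d := Nat.mul_add _ _ _
    have hinner : ∀ J, A < J → J < A + d → f J = f (J + P) := by
      intro J h1 h2
      by_contra hne
      obtain ⟨t, ht, -, hne'⟩ := hpre _ _ hne
      have e1 : q * (A + 1) ≤ q * J := Nat.mul_le_mul_left q h1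
      have e2 : q * (J + 1) ≤ q * (A + d) := Nat.mul_le_mul_left q h2
      rw [Nat.mul_succ] at e1 e2
      exact hne' (hblk J t ht (by omega) (by omega))
    have hleft : f A ≠ f (A + P) → q - r ≤ suf (f A) (f (A + P)) := by
      intro hne
      obtain ⟨t, ht, ht', hne'⟩ := hsuf _ _ hne
      by_contra hcon
      have e : q * 1 ≤ q * d := Nat.mul_le_mul_left q hd
      exact hne' (hblk A t ht (by omega) (by omega))
    have hright : f (A + d) ≠ f (A + d + P) → s ≤ pre (f (A + d)) (f (A + d + P)) := by
      intro hne
      obtain ⟨t, ht, ht', hne'⟩ := hpre _ _ hne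
      by_contra hcon
      have e : q * 1 ≤ q * d := Nat.mul_le_mul_left q hd
      exact hne' (hblk (A + d) t ht (by omega) (by omega))
    -- The endpoints `a` and `b`, according to whether the first and last blocks are repeated.
    obtain ⟨a, x, ha1, ha2, ha3, hx⟩ : ∃ a x, a ≤ A + 1 ∧ (∀ J, a ≤ J → J < A + 1 →
        f J = f (J + P)) ∧ q - r ≤ q * (A + 1 - a) + x ∧
        (x = 0 ∨ ∃ a', a = a' + 1 ∧ f a' ≠ f (a' + P) ∧ x ≤ suf (f a') (f (a' + P))) := by
      by_cases hf : f A = f (A + P)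
      · refine ⟨A, 0, by omega, fun J h1 h2 => ?_, ?_, Or.inl rfl⟩
        · obtain rfl : J = A := by omega
          exact hf
        · rw [Nat.add_sub_cancel_left]
          omega
      · exact ⟨A + 1, q - r, le_rfl, fun J h1 h2 => by omega, by omega,
          Or.inr ⟨A, rfl, hf, hleft hf⟩⟩
    obtain ⟨b, y, hb1, hb2, hb3, hb4, hy⟩ : ∃ b y, A + d ≤ b ∧ (∀ J, A + d ≤ J → J < b →
        f J = f (J + P)) ∧ s ≤ q * (b - (A + d)) + y ∧ q * b < q * (A + d) + s + q ∧
        (y = 0 ∨ f b ≠ f (b + P) ∧ y ≤ pre (f b) (f (b + P)) ∧ q * b < q * (A + d) + s) := by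
      rcases Nat.eq_zero_or_pos s with rfl | hs0
      · exact ⟨A + d, 0, le_rfl, fun J h1 h2 => by omega, by omega, by omega, Or.inl rfl⟩
      by_cases hf : f (A + d) = f (A + d + P)
      · refine ⟨A + d + 1, 0, by omega, fun J h1 h2 => ?_, ?_, ?_, Or.inl rfl⟩
        · obtain rfl : J = A + d := by omega
          exact hf
        · rw [Nat.add_sub_cancel_left]
          omega
        · rw [Nat.mul_succ]
          omega
      · exact ⟨A + d, s, le_rfl, fun J h1 h2 => by omega, by omega, by omega,
          Or.inr ⟨hf, hright hf, by omega⟩⟩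
    refine ⟨a, b, x, y, by omega, ?_, ?_, by omega, hx, by rwa [hB]⟩
    · intro J h1 h2
      by_cases e1 : J < A + 1
      · exact ha2 J h1 e1
      by_cases e2 : A + d ≤ J
      · exact hb2 J e2 h2
      exact hinner J (by omega) (by omega)
    · obtain ⟨c, hc⟩ := Nat.exists_eq_add_of_le ha1
      obtain ⟨e, rfl⟩ := Nat.exists_eq_add_of_le hb1
      obtain ⟨d, rfl⟩ := Nat.exists_eq_add_of_le' hd
      have h1 : A + (d + 1) + e - a = c + d + e := by omega
      have h2 : A + 1 - a = c := by omega
      rw [h1, Nat.mul_add, Nat.mul_add]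
      rw [h2] at ha3
      rw [Nat.add_sub_cancel_left] at hb3
      rw [Nat.mul_succ] at hmul
      omega

/-- Whether the residues `r` of all entries `(r, l)` are the same. -/
def sameResidue : List (ℕ × List ℕ) → Bool
  | [] => true
  | [_] => true
  | x :: y :: t => Nat.beq x.1 y.1 && sameResidue (y :: t)

/-- The entries `(r, l)` for which `l` starts with `c`, with this letter removed. -/
def descend (c : ℕ) : List (ℕ × List ℕ) → List (ℕ × List ℕ)
  | [] => []
  | (_, []) :: t => descend c t
  | (r, x :: l) :: t => bif Nat.beq x c then (r, l) :: descend c t else descend c t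

/-- Whether the first `L` letters of `l` determine `r`, for the given entries `(r, l)` over the
alphabet `{0, …, k - 1}`. The prefixes are read along their common tree, and a branch ends as soon
as it has only one residue. -/
def isSynchronized (k : ℕ) : ℕ → List (ℕ × List ℕ) → Bool
  | 0, X => sameResidue X
  | L + 1, X => sameResidue X || (List.range k).all fun c => isSynchronized k L (descend c X)

theorem eq_of_sameResidue {X : List (ℕ × List ℕ)} (h : sameResidue X = true) :
    ∀ x ∈ X, ∀ y ∈ X, x.1 = y.1 := by
  have key : ∀ (X : List (ℕ × List ℕ)) (z : ℕ × List ℕ), sameResidue (z :: X) = true →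
      ∀ x ∈ z :: X, x.1 = z.1 := by
    intro X
    induction X with
    | nil => intro z _ x hx; rw [List.mem_singleton.1 hx]
    | cons y t ih =>
      intro z h x hx
      rw [sameResidue, Bool.and_eq_true] at h
      rcases List.mem_cons.1 hx with rfl | hx
      · rfl
      · rw [ih y h.2 x hx, Nat.eq_of_beq_eq_true h.1]
  cases X with
  | nil => simp
  | cons z t => exact fun x hx y hy => (key t z h x hx).trans (key t z h y hy).symm

theorem mem_descend {c r : ℕ} {l : List ℕ} {X : List (ℕ × List ℕ)} (h : (r, c :: l) ∈ X) :
    (r, l) ∈ descend c X := by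
  induction X with
  | nil => simp at h
  | cons x t ih =>
    obtain ⟨r', l'⟩ := x
    rcases List.mem_cons.1 h with h' | h'
    · obtain ⟨rfl, rfl⟩ := Prod.mk.inj h'
      simp [descend]
    · cases l' with
      | nil => exact ih h'
      | cons x l' =>
        rw [descend]
        cases Nat.beq x c
        · exact ih h'
        · exact List.mem_cons_of_mem _ (ih h')

theorem eq_of_isSynchronized {k : ℕ} : ∀ {L : ℕ} {X : List (ℕ × List ℕ)},
    isSynchronized k L X = true → ∀ {r r' : ℕ} {l l' : List ℕ}, (r, l) ∈ X → (r', l') ∈ X →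
    L ≤ l.length → L ≤ l'.length → (∀ x ∈ l, x < k) → (∀ j < L, l[j]? = l'[j]?) → r = r' := by
  intro L
  induction L with
  | zero => exact fun h _ _ _ _ hl hl' _ _ _ _ => eq_of_sameResidue h _ hl _ hl'
  | succ L ih =>
    intro X h r r' l l' hl hl' h1 h2 hk hj
    rw [isSynchronized, Bool.or_eq_true, List.all_eq_true] at h
    rcases h with h | h
    · exact eq_of_sameResidue h _ hl _ hl'
    · match l, l' with
      | [], _ => simp at h1
      | _ :: _, [] => simp at h2
      | x :: l, y :: l' =>
        obtain rfl : x = y := by simpa using hj 0 (by omega)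
        refine ih (h x (List.mem_range.2 (hk x (by simp)))) (mem_descend hl) (mem_descend hl')
          (by simpa using h1) (by simpa using h2) (fun z hz => hk z (by simp [hz])) ?_
        intro j hj'
        simpa using hj (j + 1) (by omega)

/-- Whether two lists differ at one of the first `m` places; also `true` if one of them is shorter
than `m` and no difference is met. -/
def differ : ℕ → List ℕ → List ℕ → Bool
  | 0, _, _ => false
  | m + 1, x :: l, y :: l' => bif Nat.beq x y then differ m l l' else true
  | _ + 1, _, _ => true

/-- Whether `differ m` holds for the pairs of tails of `l` and `l'` at each of the first `n`
places. -/
def differFrom (m : ℕ) : ℕ → List ℕ → List ℕ → Bool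
  | 0, _, _ => true
  | n + 1, l, l' => differ m l l' && differFrom m n l.tail l'.tail

theorem differ_eq_false : ∀ {m : ℕ} {l l' : List ℕ}, m ≤ l.length → m ≤ l'.length →
    (∀ j < m, l[j]? = l'[j]?) → differ m l l' = false := by
  intro m
  induction m with
  | zero => intros; simp [differ]
  | succ m ih =>
    intro l l' h1 h2 h
    match l, l' with
    | [], _ => simp at h1
    | _ :: _, [] => simp at h2
    | x :: l, y :: l' =>
      obtain rfl : x = y := by simpa using h 0 (by omega)
      rw [differ, Nat.beq_refl]
      exact ih (by simpa using h1) (by simpa using h2) fun j hj => by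
        simpa using h (j + 1) (by omega)

theorem differFrom_eq_false {m : ℕ} : ∀ {n : ℕ} {l l' : List ℕ} {i : ℕ}, i < n →
    i + m ≤ l.length → i + m ≤ l'.length → (∀ j < m, l[i + j]? = l'[i + j]?) →
    differFrom m n l l' = false := by
  intro n
  induction n with
  | zero => intro l l' i hi; omega
  | succ n ih =>
    intro l l' i hi h1 h2 h
    rw [differFrom, Bool.and_eq_false_iff]
    cases i with
    | zero => exact Or.inl (differ_eq_false (by omega) (by omega) (by simpa using h))
    | succ i =>
      refine Or.inr (ih (i := i) (by omega) (by rw [List.length_tail]; omega)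
        (by rw [List.length_tail]; omega) ?_)
      intro j hj
      have := h j hj
      rw [List.getElem?_tail, List.getElem?_tail]
      convert this using 2 <;> omega

/-! ### Repetitions in images of uniform morphisms -/

/-- The letter at place `n` of the image of `f` under the `q`-uniform morphism with blocks `h`. -/
def imageLetter {α : Type} {k : ℕ} (h : α → List (Fin (k + 1))) (q : ℕ) (f : ℕ → α) (n : ℕ) :
    Fin (k + 1) :=
  (h (f (n / q))).getD (n % q) 0

/-- The concatenation of the blocks of `l`, as a list of numbers. -/
def blocks {α : Type} {k : ℕ} (h : α → List (Fin (k + 1))) (l : List α) : List ℕ :=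
  (l.flatMap h).map Fin.val

theorem length_flatMap_uniform {α β : Type} {h : α → List β} {q : ℕ}
    (hh : ∀ a, (h a).length = q) (l : List α) : (l.flatMap h).length = q * l.length := by
  induction l with
  | nil => rfl
  | cons a l ih => rw [List.flatMap_cons, List.length_append, hh, ih, List.length_cons]; ring

theorem getD_flatMap_uniform {α β : Type} {h : α → List β} {q : ℕ} (hq : 0 < q)
    (hh : ∀ a, (h a).length = q) {l : List α} {n : ℕ} (hn : n < q * l.length) (a : α) (b : β) :
    (l.flatMap h).getD n b = (h (l.getD (n / q) a)).getD (n % q) b := by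
  induction l generalizing n with
  | nil => simp at hn
  | cons c l ih =>
    rw [List.flatMap_cons]
    rw [List.length_cons, Nat.mul_succ] at hn
    by_cases hlt : n < q
    · rw [List.getD_append _ _ _ _ (by rwa [hh]), Nat.div_eq_of_lt hlt, Nat.mod_eq_of_lt hlt,
        List.getD_cons_zero]
    · obtain ⟨m, rfl⟩ := Nat.exists_eq_add_of_le (not_lt.1 hlt)
      rw [List.getD_append_right _ _ _ _ (by rw [hh]; omega), hh, Nat.add_sub_cancel_left,
        ih (by omega), Nat.add_mod_left, Nat.add_div_left _ hq, List.getD_cons_succ]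

theorem blocks_getElem? {α : Type} {k : ℕ} {h : α → List (Fin (k + 1))} {q : ℕ} (hq : 0 < q)
    (hh : ∀ a, (h a).length = q) (f : ℕ → α) (A t N : ℕ) (ht : t < q * N) :
    (blocks h (List.ofFn fun j : Fin N => f (A + j)))[t]? =
      some (imageLetter h q f (q * A + t)).val := by
  have hlen : t < ((List.ofFn fun j : Fin N => f (A + j)).flatMap h).length := by
    rw [length_flatMap_uniform hh, List.length_ofFn]
    exact ht
  have hdiv : t / q < N := Nat.div_lt_of_lt_mul ht
  have hletter : (List.ofFn fun j : Fin N => f (A + j)).getD (t / q) (f A) = f (A + t / q) := by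
    rw [List.getD_eq_getElem _ _ (by simpa using hdiv)]
    simp
  rw [blocks, List.getElem?_map, List.getElem?_eq_getElem hlen, Option.map_some,
    ← List.getD_eq_getElem _ 0 hlen, getD_flatMap_uniform hq hh (by simpa using ht) (f A),
    hletter, imageLetter, Nat.mul_add_mod, Nat.mul_add_div hq]

/-- The suffixes that start in the first block of the image of a word `ab` with `a ≠ b`, together
with their starting places. -/
def windows {k : ℕ} (h : Fin 3 → List (Fin (k + 1))) (q : ℕ) : List (ℕ × List ℕ) :=
  [[0, 1], [0, 2], [1, 0], [1, 2], [2, 0], [2, 1]].flatMap fun l =>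
    (List.range q).map fun r => (r, (blocks h l).drop r)

/-- Whether no image of a word `abc` with `a ≠ b ≠ c` has, at a place in the first block, a
repetition of period `p ≤ N` and exponent greater than `1 + s / t`. -/
def shortPeriodsOk {k : ℕ} (h : Fin 3 → List (Fin (k + 1))) (q s t N : ℕ) : Bool :=
  [[0, 1, 0], [0, 1, 2], [0, 2, 0], [0, 2, 1], [1, 0, 1], [1, 0, 2], [1, 2, 0], [1, 2, 1],
    [2, 0, 1], [2, 0, 2], [2, 1, 0], [2, 1, 2]].all fun l =>
    (List.range N).all fun p =>
      differFrom (s * (p + 1) / t + 1) q (blocks h l) ((blocks h l).drop (p + 1))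

theorem mem_pairs : ∀ {a b : Fin 3}, a ≠ b →
    [a, b] ∈ ([[0, 1], [0, 2], [1, 0], [1, 2], [2, 0], [2, 1]] : List (List (Fin 3))) := by
  decide

theorem mem_triples : ∀ {a b c : Fin 3}, a ≠ b → b ≠ c →
    [a, b, c] ∈ ([[0, 1, 0], [0, 1, 2], [0, 2, 0], [0, 2, 1], [1, 0, 1], [1, 0, 2], [1, 2, 0],
      [1, 2, 1], [2, 0, 1], [2, 0, 2], [2, 1, 0], [2, 1, 2]] : List (List (Fin 3))) := by
  decide

/-- Equal windows of length `L` of an image start at the same place of a block. -/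
theorem mod_eq_of_isSynchronized {k : ℕ} {h : Fin 3 → List (Fin (k + 1))} {q L : ℕ} (hq : 0 < q)
    (hh : ∀ a, (h a).length = q) (hL : isSynchronized (k + 1) L (windows h q) = true)
    (hLq : L ≤ q) {f : ℕ → Fin 3} (hf : ∀ n, f n ≠ f (n + 1)) {i i' : ℕ}
    (hi : ∀ j < L, imageLetter h q f (i + j) = imageLetter h q f (i' + j)) : i % q = i' % q := by
  have hmem : ∀ n, (n % q, (blocks h [f (n / q), f (n / q + 1)]).drop (n % q)) ∈ windows h q := by
    intro n
    exact List.mem_flatMap.2 ⟨_, mem_pairs (hf (n / q)), List.mem_map.2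
      ⟨n % q, List.mem_range.2 (Nat.mod_lt _ hq), rfl⟩⟩
  have hlen : ∀ n, L ≤ ((blocks h [f (n / q), f (n / q + 1)]).drop (n % q)).length := by
    intro n
    have := Nat.mod_lt n hq
    rw [List.length_drop, blocks, List.length_map, length_flatMap_uniform hh]
    simp only [List.length_cons, List.length_nil]
    omega
  have hget : ∀ n, ∀ j < L, ((blocks h [f (n / q), f (n / q + 1)]).drop (n % q))[j]? =
      some (imageLetter h q f (n + j)).val := by
    intro n j hj
    have hlt := Nat.mod_lt n hq
    have h1 := blocks_getElem? hq hh f (n / q) (n % q + j) 2 (by omega)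
    rw [← Nat.add_assoc, Nat.div_add_mod] at h1
    rw [List.getElem?_drop, ← h1]
    simp [List.ofFn_succ]
  refine eq_of_isSynchronized hL (hmem i) (hmem i') (hlen i) (hlen i') ?_ ?_
  · intro x hx
    obtain ⟨y, -, rfl⟩ := List.mem_map.1 (List.mem_of_mem_drop hx)
    exact y.isLt
  · intro j hj
    rw [hget i j hj, hget i' j hj, hi j hj]

/-- A repetition in an image whose period is not a multiple of the block length `q` has exponent at
most `1 + s / t`: two equal windows of length `L` start at places that are congruent modulo `q`, so
a counterexample has an excess smaller than `L`, and is excluded by the check of short periods. -/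
theorem excess_le_of_not_dvd {k : ℕ} {h : Fin 3 → List (Fin (k + 1))} {q L s t N : ℕ} (hq : 0 < q)
    (hh : ∀ a, (h a).length = q) (hL : isSynchronized (k + 1) L (windows h q) = true)
    (hLq : L ≤ q) (ht : 0 < t) (hN : ∀ p, s * p / t + 1 < L → p ≤ N)
    (hNL : N + L ≤ 2 * q) (hshort : shortPeriodsOk h q s t N = true)
    {f : ℕ → Fin 3} (hf : ∀ n, f n ≠ f (n + 1)) {i p m : ℕ} (hp : p % q ≠ 0)
    (hm : ∀ j < m, imageLetter h q f (i + j) = imageLetter h q f (i + j + p)) :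
    t * m ≤ s * p := by
  by_contra hcon
  have hle : s * p / t + 1 ≤ m :=
    (Nat.div_lt_iff_lt_mul ht).2 (by rw [mul_comm m]; exact not_le.1 hcon)
  by_cases hlt : s * p / t + 1 < L
  · have hpN := hN p hlt
    have hp0 : p ≠ 0 := by rintro rfl; exact hp (Nat.zero_mod q)
    obtain ⟨p', rfl⟩ : ∃ p', p = p' + 1 := ⟨p - 1, by omega⟩
    rw [shortPeriodsOk, List.all_eq_true] at hshort
    have h1 := hshort _ (mem_triples (hf (i / q)) (hf (i / q + 1)))
    rw [List.all_eq_true] at h1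
    have h2 := h1 p' (List.mem_range.2 (by omega))
    have hir := Nat.mod_lt i hq
    have hlen : (blocks h [f (i / q), f (i / q + 1), f (i / q + 1 + 1)]).length = q * 3 := by
      rw [blocks, List.length_map, length_flatMap_uniform hh]
      rfl
    have hget : ∀ j, i % q + j < q * 3 →
        (blocks h [f (i / q), f (i / q + 1), f (i / q + 1 + 1)])[i % q + j]? =
        some (imageLetter h q f (i + j)).val := by
      intro j hj
      have h3 := blocks_getElem? hq hh f (i / q) (i % q + j) 3 hj
      rw [← Nat.add_assoc, Nat.div_add_mod] at h3
      rw [← h3]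
      simp [List.ofFn_succ]
    rw [differFrom_eq_false hir] at h2
    · cases h2
    · rw [hlen]
      omega
    · rw [List.length_drop, hlen]
      omega
    · intro j hj
      rw [List.getElem?_drop, show p' + 1 + (i % q + j) = i % q + (j + (p' + 1)) by ring,
        hget _ (by omega), hget _ (by omega), hm j (by omega), Nat.add_assoc]
  · have h1 := mod_eq_of_isSynchronized hq hh hL hLq hf (i := i) (i' := i + p) (by
      intro j hj
      rw [hm j (by omega)]
      congr 1
      ring)
    have h2 : (i + 0) ≡ (i + p) [MOD q] := h1
    exact hp (Nat.ModEq.add_left_cancel' i h2).symm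

/-! ### Finite checks for the two morphisms -/

/-- Dejean's `19`-uniform morphism, whose blocks are cyclic shifts of the alphabet of each other. -/
def dejeanMorphism : Fin 3 → List (Fin 3)
  | 0 => [0, 1, 2, 0, 2, 1, 2, 0, 1, 2, 1, 0, 2, 1, 2, 0, 2, 1, 0]
  | 1 => [1, 2, 0, 1, 0, 2, 0, 1, 2, 0, 2, 1, 0, 2, 0, 1, 0, 2, 1]
  | 2 => [2, 0, 1, 2, 1, 0, 1, 2, 0, 1, 0, 2, 1, 0, 1, 2, 1, 0, 2]

theorem length_dejeanMorphism (a : Fin 3) : (dejeanMorphism a).length = 19 := by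
  fin_cases a <;> rfl

theorem isSynchronized_dejeanMorphism : isSynchronized 3 10 (windows dejeanMorphism 19) = true := by
  decide +kernel

/-- An excess greater than `3 / 4 * p` but smaller than the synchronization length `10` requires
`p ≤ 11`. -/
theorem shortPeriodsOk_dejeanMorphism : shortPeriodsOk dejeanMorphism 19 3 4 11 = true := by
  decide +kernel

theorem isSynchronized_deanMorphism : isSynchronized 4 52 (windows deanMorphism 100) = true := by
  decide +kernel

/-- An excess greater than `7 / 8 * p` but smaller than the synchronization length `52` requires
`p ≤ 58`. -/
theorem shortPeriodsOk_deanMorphism : shortPeriodsOk deanMorphism 100 7 8 58 = true := by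
  decide +kernel

/-! ### Dejean's word and continuations of finite words -/

/-- The fixed point of Dejean's morphism that starts with `0`. -/
def dejeanWord (n : ℕ) : Fin 3 :=
  if n = 0 then 0 else (dejeanMorphism (dejeanWord (n / 19))).getD (n % 19) 0
termination_by n
decreasing_by omega

theorem dejeanWord_eq (n : ℕ) : dejeanWord n = imageLetter dejeanMorphism 19 dejeanWord n := by
  rw [imageLetter, dejeanWord]
  split_ifs with h
  · subst h
    rw [Nat.zero_div, Nat.zero_mod, dejeanWord]
    rfl
  · rfl

theorem dejeanMorphism_inner_ne : ∀ a : Fin 3, ∀ r < 18,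
    (dejeanMorphism a).getD r 0 ≠ (dejeanMorphism a).getD (r + 1) 0 := by
  decide

theorem dejeanMorphism_boundary_ne : ∀ a b : Fin 3, a ≠ b →
    (dejeanMorphism a).getD 18 0 ≠ (dejeanMorphism b).getD 0 0 := by
  decide

theorem dejeanMorphism_getD_ne : ∀ a b : Fin 3, a ≠ b → ∀ r < 19,
    (dejeanMorphism a).getD r 0 ≠ (dejeanMorphism b).getD r 0 := by
  decide

theorem dejeanWord_ne_succ (n : ℕ) : dejeanWord n ≠ dejeanWord (n + 1) := by
  induction n using Nat.strong_induction_on with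
  | _ n ih =>
    rw [dejeanWord_eq n, dejeanWord_eq (n + 1), imageLetter, imageLetter]
    by_cases h : n % 19 < 18
    · rw [show (n + 1) / 19 = n / 19 by omega, show (n + 1) % 19 = n % 19 + 1 by omega]
      exact dejeanMorphism_inner_ne _ _ h
    · rw [show (n + 1) / 19 = n / 19 + 1 by omega, show (n + 1) % 19 = 0 by omega,
        show n % 19 = 18 by omega]
      exact dejeanMorphism_boundary_ne _ _ (ih _ (by omega))

/-- Dejean's theorem for three letters. Two distinct blocks differ at every place, so that a
repetition with a period divisible by `19` is exactly the image of one of the same exponent. -/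
theorem dejeanWord_excess_le (p : ℕ) : ∀ i m : ℕ, 1 ≤ p →
    (∀ j < m, dejeanWord (i + j) = dejeanWord (i + j + p)) → 4 * m ≤ 3 * p := by
  induction p using Nat.strong_induction_on with
  | _ p ih =>
    intro i m hp hm
    by_cases hpq : p % 19 = 0
    · obtain ⟨P, rfl⟩ := Nat.dvd_of_mod_eq_zero hpq
      rcases Nat.eq_zero_or_pos m with rfl | hm0
      · omega
      rcases exists_preimage_stretch (blk := fun a r => (dejeanMorphism a).getD r 0) (q := 19)
        (R := 0) (pre := fun _ _ => 0) (suf := fun _ _ => 0) (by omega)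
        (fun a b h => ⟨0, by omega, le_rfl, dejeanMorphism_getD_ne a b h 0 (by omega)⟩)
        (fun a b h => ⟨18, by omega, le_rfl, dejeanMorphism_getD_ne a b h 18 (by omega)⟩)
        (fun a b h i hi => ⟨0, le_rfl, dejeanMorphism_getD_ne a b h i hi⟩)
        (f := dejeanWord) (i := i) (P := P) hm0 (by
          intro j hj
          have := hm j hj
          rwa [dejeanWord_eq (i + j), dejeanWord_eq (i + j + 19 * P), imageLetter, imageLetter,
            Nat.add_mul_div_left _ _ (by omega : 0 < 19), Nat.add_mul_mod_self_left] at this)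
        with h | ⟨a, b, x, y, hab, heq, hle, -, hx, hy⟩
      · omega
      · have hx0 : x = 0 := by
          rcases hx with h | ⟨_, -, -, h⟩
          exacts [h, Nat.le_zero.1 h]
        have hy0 : y = 0 := by
          rcases hy with h | ⟨-, h, -⟩
          exacts [h, Nat.le_zero.1 h]
        clear hx hy
        have h1 : 4 * (b - a) ≤ 3 * P := ih P (by omega) a (b - a) (by omega) fun j hj =>
          heq (a + j) (by omega) (by omega)
        omega
    · refine excess_le_of_not_dvd (by omega) length_dejeanMorphism isSynchronized_dejeanMorphism
        (by omega) (by omega) (fun p hp => by omega) (by omega) shortPeriodsOk_dejeanMorphism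
        dejeanWord_ne_succ hpq (i := i) ?_
      simpa only [← dejeanWord_eq] using hm

theorem isPlusFree_seven_div_four_iff (w : CWord (Fin 3)) : w.IsPlusFree (7 / 4) ↔
    ∀ i p m : ℕ, 1 ≤ p → ((i + (p + m) : ℕ) : ℕ∞) ≤ w.length →
      (∀ j < m, w.letter (i + j) = w.letter (i + j + p)) → 4 * m ≤ 3 * p := by
  rw [← isPlusFree_iff w (by omega)]
  norm_num

theorem isPlusFree_dejeanWord : (infinite dejeanWord).IsPlusFree (7 / 4) :=
  (isPlusFree_seven_div_four_iff _).2 fun i p m hp _ h => dejeanWord_excess_le p i m hp h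

/-- A continuation of `u` to an infinite sequence, in which no two consecutive letters after the
end of `u` are equal. -/
def continuation (u : CWord (Fin 3)) : ℕ → Fin 3
  | 0 => u.letter 0
  | n + 1 => open Classical in
    if ((n + 2 : ℕ) : ℕ∞) ≤ u.length then u.letter (n + 1) else continuation u n + 1

theorem continuation_eq {u : CWord (Fin 3)} {n : ℕ} (h : ((n + 1 : ℕ) : ℕ∞) ≤ u.length) :
    continuation u n = u.letter n := by
  cases n with
  | zero => rfl
  | succ n => rw [continuation, if_pos h]

theorem continuation_ne_succ {u : CWord (Fin 3)} (hu : u.IsPlusFree (7 / 4)) (n : ℕ) :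
    continuation u n ≠ continuation u (n + 1) := by
  by_cases h : ((n + 2 : ℕ) : ℕ∞) ≤ u.length
  · rw [continuation_eq h, continuation_eq (le_trans (by exact_mod_cast Nat.le_succ _) h)]
    intro heq
    have := (isPlusFree_seven_div_four_iff u).1 hu n 1 1 le_rfl h (by
      intro j hj
      obtain rfl : j = 0 := by omega
      exact heq)
    omega
  · rw [continuation, if_neg h]
    generalize continuation u n = c
    revert c
    decide

theorem le_length_image {α β : Type} {h : α → List β} {q : ℕ} (hq : 0 < q)
    (hh : ∀ a, (h a).length = q) (u : CWord α) {n : ℕ}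
    (hn : (n : ℕ∞) ≤ (u.image h q hq hh).length) {k : ℕ} (hk : q * k < n + q) :
    (k : ℕ∞) ≤ u.length := by
  cases u with
  | finite l =>
    simp only [image, length, Nat.cast_le, length_flatMap_uniform hh] at hn ⊢
    by_contra hcon
    have := Nat.mul_le_mul_left q (not_le.1 hcon)
    rw [Nat.mul_succ] at this
    omega
  | infinite f => exact le_top

theorem letter_image {k : ℕ} {h : Fin 3 → List (Fin (k + 1))} {q : ℕ} (hq : 0 < q)
    (hh : ∀ a, (h a).length = q) (u : CWord (Fin 3)) {n : ℕ}
    (hn : ((n + 1 : ℕ) : ℕ∞) ≤ (u.image h q hq hh).length) :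
    (u.image h q hq hh).letter n = imageLetter h q (continuation u) n := by
  have hdm := Nat.div_add_mod n q
  rw [imageLetter, continuation_eq (le_length_image hq hh u hn (by rw [Nat.mul_succ]; omega))]
  cases u with
  | finite l =>
    simp only [image, length, Nat.cast_le, length_flatMap_uniform hh] at hn
    exact getD_flatMap_uniform hq hh hn _ _
  | infinite f =>
    simp only [image, letter]
    rw [List.getD_eq_getElem]

/-! ### Images under the morphism to Dean words -/

/-- A bound for the length of a common prefix of two distinct blocks of `deanMorphism`. -/
def commonPrefixBound (a b : Fin 3) : ℕ := if a = 0 ∨ b = 0 then 3 else 23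

/-- A bound for the length of a common suffix of two distinct blocks of `deanMorphism`. -/
def commonSuffixBound (a b : Fin 3) : ℕ := if a = 0 ∨ b = 0 then 4 else 28

theorem deanMorphism_prefix : ∀ a b : Fin 3, a ≠ b → ∃ r < 100, r ≤ commonPrefixBound a b ∧
    (deanMorphism a).getD r 0 ≠ (deanMorphism b).getD r 0 := by
  decide +kernel

theorem deanMorphism_suffix : ∀ a b : Fin 3, a ≠ b → ∃ r < 100,
    100 ≤ r + commonSuffixBound a b + 1 ∧
      (deanMorphism a).getD r 0 ≠ (deanMorphism b).getD r 0 := by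
  decide +kernel

/-- Distinct blocks have no common stretch of `29` letters at the same place. -/
theorem deanMorphism_inner : ∀ a b : Fin 3, a ≠ b → ∀ i < 72, ∃ j < 29,
    (deanMorphism a).getD (i + j) 0 ≠ (deanMorphism b).getD (i + j) 0 := by
  decide +kernel

/-- The words of length `2` and `3` that do not occur in images under `deanMorphism`. -/
def forbiddenWords : List (List (Fin 4)) :=
  [[0, 2], [2, 0], [1, 3], [3, 1], [0, 1, 0], [0, 3, 2], [2, 1, 2], [3, 0, 3], [3, 2, 3]]

theorem length_forbiddenWords : ∀ v ∈ forbiddenWords, v.length ≤ 3 := by decide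

theorem deanMorphism_forbiddenWords : ∀ a b : Fin 3, a ≠ b → ∀ r < 100, ∀ v ∈ forbiddenWords,
    ¬ v <+: (deanMorphism a ++ deanMorphism b).drop r := by
  decide +kernel

theorem avoids_of_mem_forbiddenWords {u : CWord (Fin 3)} (hu : u.IsPlusFree (7 / 4))
    {v : List (Fin 4)} (hv : v ∈ forbiddenWords) :
    (u.image deanMorphism 100 (by norm_num) deanMorphism_length).Avoids v := by
  intro hf
  obtain ⟨i, hi, hl⟩ := (hasFactor_iff _ v).1 hf
  have hlen := length_forbiddenWords v hv
  have hir := Nat.mod_lt i (by omega : 0 < 100)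
  set a := continuation u (i / 100) with ha
  set b := continuation u (i / 100 + 1) with hb
  refine deanMorphism_forbiddenWords a b (continuation_ne_succ hu _) (i % 100) hir v hv ?_
  rw [List.prefix_iff_getElem?]
  intro j hj
  rw [hl j hj, letter_image (by norm_num) deanMorphism_length u
    (le_trans (by exact_mod_cast (by omega : i + j + 1 ≤ i + v.length)) hi), imageLetter,
    List.getElem?_drop]
  have hdm := Nat.div_add_mod i 100
  by_cases hlt : i % 100 + j < 100
  · rw [List.getElem?_append_left (by rwa [deanMorphism_length]),
      show (i + j) / 100 = i / 100 by omega, show (i + j) % 100 = i % 100 + j by omega, ← ha,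
      List.getD_eq_getElem _ _ (by rwa [deanMorphism_length]), List.getElem?_eq_getElem]
  · rw [List.getElem?_append_right (by rw [deanMorphism_length]; omega), deanMorphism_length,
      show (i + j) / 100 = i / 100 + 1 by omega, show (i + j) % 100 = i % 100 + j - 100 by omega,
      ← hb, List.getD_eq_getElem _ _ (by rw [deanMorphism_length]; omega),
      List.getElem?_eq_getElem]

/-- In a sequence over three letters, a stretch of length `3` that agrees with its shift by `4` and
is flanked by the letters `1` and `2` on both sides contains a square of period `2`. -/
theorem exists_square_of_period_four : ∀ a x y z e b : Fin 3,
    (a ≠ 0 ∧ e ≠ 0 ∧ b ≠ 0) ∧ (a ≠ e ∧ e ≠ b) ∧ (a ≠ x ∧ x ≠ y ∧ y ≠ z ∧ z ≠ e ∧ e ≠ x ∧ z ≠ b) →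
    (a = y ∧ x = z) ∨ (x = z ∧ y = e) := by
  decide

/-- Images of `7/4⁺`-free words are `15/8⁺`-free, in terms of periods and excesses. The letters of
`imageLetter` beyond the image of a finite `u` are irrelevant because of `hfit`. -/
theorem image_deanMorphism_excess_le {u : CWord (Fin 3)} (hu : u.IsPlusFree (7 / 4)) {i p m : ℕ}
    (hp : 1 ≤ p) (hfit : ((i + (p + m) : ℕ) : ℕ∞) ≤
      (u.image deanMorphism 100 (by norm_num) deanMorphism_length).length)
    (hm : ∀ j < m, imageLetter deanMorphism 100 (continuation u) (i + j) =
      imageLetter deanMorphism 100 (continuation u) (i + j + p)) : 8 * m ≤ 7 * p := by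
  have hne := continuation_ne_succ hu
  by_cases hpq : p % 100 = 0
  swap
  · exact excess_le_of_not_dvd (by omega) deanMorphism_length isSynchronized_deanMorphism
      (by omega) (by omega) (fun p hp => by omega) (by omega) shortPeriodsOk_deanMorphism hne hpq
      hm
  obtain ⟨P, rfl⟩ := Nat.dvd_of_mod_eq_zero hpq
  have hlen : ∀ k, 100 * k < i + (100 * P + m) + 100 → ((k : ℕ) : ℕ∞) ≤ u.length := fun k hk =>
    le_length_image (by norm_num) deanMorphism_length u hfit hk
  have hfree : ∀ a Q n : ℕ, 1 ≤ Q → 100 * (a + (Q + n)) < i + (100 * P + m) + 100 →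
      (∀ j < n, continuation u (a + j) = continuation u (a + j + Q)) → 4 * n ≤ 3 * Q := by
    intro a Q n hQ h1 h2
    refine (isPlusFree_seven_div_four_iff u).1 hu a Q n hQ (hlen _ h1) fun j hj => ?_
    rw [← continuation_eq (hlen _ (by omega)), ← continuation_eq (hlen _ (by omega))]
    exact h2 j hj
  rcases Nat.eq_zero_or_pos m with rfl | hm0
  · omega
  rcases exists_preimage_stretch (blk := fun a r => (deanMorphism a).getD r 0) (q := 100)
    (R := 28) (by omega) deanMorphism_prefix deanMorphism_suffix
    (fun a b h i hi => by
      obtain ⟨j, hj, hj'⟩ := deanMorphism_inner a b h i (by omega)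
      exact ⟨j, by omega, hj'⟩)
    (f := continuation u) (i := i) (P := P) hm0 (by
      intro j hj
      have := hm j hj
      rwa [imageLetter, imageLetter, Nat.add_mul_div_left _ _ (by omega : 0 < 100),
        Nat.add_mul_mod_self_left] at this)
    with h | ⟨a, b, x, y, hab, heq, hle, hb, hx, hy⟩
  · omega
  have hM : 4 * (b - a) ≤ 3 * P := by
    clear hx hy
    exact hfree a P (b - a) (by omega) (by omega) fun j hj => heq (a + j) (by omega) (by omega)
  have hx28 : x ≤ 28 := by
    rcases hx with rfl | ⟨_, -, -, h⟩
    · omega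
    · refine h.trans ?_
      unfold commonSuffixBound
      split_ifs <;> omega
  have hy23 : y ≤ 23 := by
    rcases hy with rfl | ⟨-, h, -⟩
    · omega
    · refine h.trans ?_
      unfold commonPrefixBound
      split_ifs <;> omega
  by_contra hcon
  -- Only `P = 4`, with an excess of `3` and the longest possible flanks, is left.
  obtain ⟨rfl, h3, rfl, rfl⟩ : P = 4 ∧ b - a = 3 ∧ x = 28 ∧ y = 23 := by
    clear hx hy
    have hP : P ≤ 4 := by omega
    interval_cases P <;> omega
  rcases hx with h | ⟨a, rfl, hx1, hx2⟩
  · omega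
  rcases hy with h | ⟨hy1, hy2, hy3⟩
  · omega
  obtain rfl : b = a + 4 := by omega
  have hx0 : continuation u a ≠ 0 ∧ continuation u (a + 4) ≠ 0 := by
    rw [← not_or]
    intro h
    rw [commonSuffixBound, if_pos h] at hx2
    omega
  have hy0 : continuation u (a + 4 + 4) ≠ 0 := by
    intro h
    rw [commonPrefixBound, if_pos (Or.inr h)] at hy2
    omega
  have e1 := heq (a + 1) (by omega) (by omega)
  have e2 := heq (a + 2) (by omega) (by omega)
  have e3 := heq (a + 3) (by omega) (by omega)
  rcases exists_square_of_period_four _ _ _ _ _ _ ⟨⟨hx0.1, hx0.2, hy0⟩, ⟨hx1, hy1⟩, hne a,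
    hne (a + 1), hne (a + 2), hne (a + 3), by rw [e1]; exact hne (a + 4),
    by rw [e3]; exact hne (a + 3 + 4)⟩ with ⟨h1, h2⟩ | ⟨h1, h2⟩
  · have := hfree a 2 2 (by omega) (by omega) (by
      intro j hj
      interval_cases j
      exacts [h1, h2])
    omega
  · have := hfree (a + 1) 2 2 (by omega) (by omega) (by
      intro j hj
      interval_cases j
      exacts [h1, h2])
    omega

theorem isGood_image_deanMorphism {u : CWord (Fin 3)} (hu : u.IsPlusFree (7 / 4)) :
    (u.image deanMorphism 100 (by norm_num) deanMorphism_length).IsGood := by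
  have hfree : (u.image deanMorphism 100 (by norm_num) deanMorphism_length).IsPlusFree
      (15 / 8) := by
    have h := isPlusFree_iff (u.image deanMorphism 100 (by norm_num) deanMorphism_length)
      (a := 7) (b := 8) (by omega)
    rw [show (15 / 8 : ℚ) = 1 + ((7 : ℕ) : ℚ) / ((8 : ℕ) : ℚ) by norm_num, h]
    intro i p m hp hfit hm
    refine image_deanMorphism_excess_le hu hp hfit fun j hj => ?_
    rw [← letter_image (by norm_num) deanMorphism_length u
        (le_trans (by exact_mod_cast (by omega)) hfit),
      ← letter_image (by norm_num) deanMorphism_length u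
        (le_trans (by exact_mod_cast (by omega)) hfit)]
    exact hm j hj
  have hav : ∀ v ∈ forbiddenWords, _ := fun v hv => avoids_of_mem_forbiddenWords hu hv
  simp only [forbiddenWords, List.forall_mem_cons] at hav
  obtain ⟨h1, h2, h3, h4, h5, h6, h7, h8, h9, -⟩ := hav
  exact ⟨hfree, ⟨⟨h1, h2, h3, h4⟩, hfree.isSquareFree (by norm_num)⟩, h5, h6, h7, h8, h9⟩

end DeanWords

theorem mainTheorem10 :
    (∃ w : ℕ → Fin 4, (CWord.infinite w).IsGood) ∧
    (∀ u : CWord (Fin 3), u.IsPlusFree (7 / 4) →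
      (u.image deanMorphism 100 (by norm_num) deanMorphism_length).IsGood) ∧
    (∀ w : CWord (Fin 4), w.IsDean → w.IsFree (15 / 8) → 5 ≤ w.numMinAbsent 3 →
      w.length ≤ 136) :=
  ⟨⟨_, DeanWords.isGood_image_deanMorphism DeanWords.isPlusFree_dejeanWord⟩,
    fun _ hu => DeanWords.isGood_image_deanMorphism hu,
    fun _ hw hfree h5 => DeanWords.length_le_of_numMinAbsent hw hfree h5⟩
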